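/- A hypergraph is a triple $G=(V(G),E(G),f_G)$ with finite sets $V(G)$ of vertices and $E(G)$ of edges and an incidence function $f_G\colon E(G)\to\mathcal P(V(G))\setminus\{\emptyset\}$; parallel edges are allowed, i.e. $f_G$ need not be injective. Its incidence graph is the bipartite graph on the disjoint union $V(G)\,\dot\cup\,E(G)$ in which $v\in V(G)$ and $e\in E(G)$ are adjacent if and only if $v\in f_G(e)$; the hypergraph is called connected, respectively Berge-acyclic, if its incidence graph is connected, respectively acyclic. A homomorphism from $F$ to $G$ is a pair of maps $h_V\colon V(F)\to V(G)$, $h_E\colon E(F)\to E(G)$ with $h_V(f_F(e))=f_G(h_E(e))$ for all $e\in E(F)$, and $\mathsf{Hom}(F,G)$ denotes the number of homomorphisms from $F$ to $G$. Colour refinement on $G$ sets $c^G_0(v):=1$ for all $v\in V(G)$ and, for $i\ge 0$, $$c^G_{i+1}(v):=\{\!\{\,\{\!\{c^G_i(u)\mid u\in f_G(e)\}\!\}\;\mid\; e\in E(G)\text{ with }v\in f_G(e)\,\}\!\},$$ where $\{\!\{\cdot\}\!\}$ denotes multisets. It distinguishes $G$ and $H$ if there is an $i\ge 0$ with $\{\!\{c^G_i(v)\mid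 v\in V(G)\}\!\}\ne\{\!\{c^H_i(v)\mid v\in V(H)\}\!\}$. Theorem. For all hypergraphs $G$ and $H$, the following are equivalent: 1. $\mathsf{Hom}(B,G)=\mathsf{Hom}(B,H)$ for every connected Berge-acyclic hypergraph $B$. 2. Colour refinement does not distinguish $G$ and $H$. -/

import Mathlib

/-- A hypergraph with vertex set `V` and edge set `E`: every edge is assigned a non-empty set of
vertices. Distinct edges may have the same vertices (parallel edges). -/
structure MultiHypergraph (V E : Type*) where
  /-- The incidence function. -/
  inc : E → Finset V
  inc_nonempty : ∀ e, (inc e).Nonempty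

namespace MultiHypergraph

/-- The incidence graph: the bipartite graph on the disjoint union of the vertices and the edges
in which `v` and `e` are adjacent iff `v` belongs to `e`. -/
def incGraph {V E : Type*} (G : MultiHypergraph V E) : SimpleGraph (V ⊕ E) where
  Adj
    | .inl v, .inr e => v ∈ G.inc e
    | .inr e, .inl v => v ∈ G.inc e
    | _, _ => False
  symm := ⟨by rintro (v | e) (w | d) h <;> exact h⟩
  loopless := ⟨by rintro (v | e) h <;> exact h⟩

/-- A hypergraph is connected if its incidence graph is. -/
def IsConnected {V E : Type*} (G : MultiHypergraph V E) : Prop :=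
  G.incGraph.Connected

/-- A hypergraph is Berge-acyclic if its incidence graph is acyclic. -/
def IsBergeAcyclic {V E : Type*} (G : MultiHypergraph V E) : Prop :=
  G.incGraph.IsAcyclic

/-- A homomorphism of hypergraphs: a pair of maps, on vertices and on edges, such that the image
of the vertex set of an edge is exactly the vertex set of the image edge. -/
structure Hom {V E V' E' : Type*} (F : MultiHypergraph V E) (G : MultiHypergraph V' E') where
  onV : V → V'
  onE : E → E'
  image_inc : ∀ e, onV '' (F.inc e : Set V) = (G.inc (onE e) : Set V')

/-- The number of homomorphisms from `F` to `G` (both are finite wherever this is used). -/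
noncomputable def homCount {V E V' E' : Type*}
    (F : MultiHypergraph V E) (G : MultiHypergraph V' E') : ℕ :=
  Nat.card (Hom F G)

/-- The colours used in round `i` of colour refinement: a single colour in round `0`, and
multisets of multisets of the previous colours afterwards. -/
def Color : ℕ → Type
  | 0 => Unit
  | i + 1 => Multiset (Multiset (Color i))

open Classical in
/-- Colour refinement: all vertices get the same colour in round `0`, and the colour of `v` in
round `i + 1` is the multiset, over the edges `e` containing `v`, of the multisets of the colours
in round `i` of the vertices of `e`. -/
noncomputable def color {V E : Type*} [Fintype E] (G : MultiHypergraph V E) :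
    (i : ℕ) → V → Color i
  | 0, _ => ()
  | i + 1, v =>
      (Finset.univ.filter (fun e : E => v ∈ G.inc e)).val.map
        (fun e => (G.inc e).val.map (fun u => color G i u))

/-- Colour refinement distinguishes `G` and `H` if in some round the multisets of all vertex
colours of `G` and of `H` differ. -/
def ColorRefinementDistinguishes {V E V' E' : Type*} [Fintype V] [Fintype E] [Fintype V']
    [Fintype E'] (G : MultiHypergraph V E) (H : MultiHypergraph V' E') : Prop :=
  ∃ i : ℕ, (Finset.univ : Finset V).val.map (G.color i) ≠
    (Finset.univ : Finset V').val.map (H.color i)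

end MultiHypergraph

/-! Both directions work with rooted counts: the number of homomorphisms from a tree-like hypergraph
`B` to `G` that send a fixed root to `v`.

If colour refinement does not distinguish `G` and `H`, take `N` larger than all ranks in `B`. When
`v` and `w` share their colour in round `N`, the edges at `v` and at `w` can be matched, and the
vertices of matched edges can be matched so that colours of the previous round agree. Iterating this
down the tree turns a homomorphism with root image `v` into one with root image `w`, losing one or
more rounds at each level (`exists_local_embedding`, `rootedHomCount_le_of_color_eq`). The transport
is injective, so by symmetry the rooted counts agree, and they are summed along a colour-preserving
bijection of the vertices.

Conversely, let the profile of `v` be the family of all its rooted counts. Gluing trees at the root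
multiplies counts, so the count functions form a monoid, which separates profiles by definition. By
a finite Stone-Weierstrass argument every function of the profile is a linear combination of counts
(`exists_profile_coeff`). Applied to indicators, this makes the multisets of profiles of `G` and `H`
equal (`map_profile_eq`). Grafting trees onto a new edge then shows that the profile of `v`
determines how many ways there are to cover edges at `v` by sequences of vertices with prescribed
profiles (`sum_cover_prod_eq`). Sequences may repeat vertices, but an induction on edge size removes
this defect (`edgeColors_eq`). Hence equality of profiles is stable under refinement and implies
equality of colours in every round. -/

open Classical in
theorem Finset.exists_equiv_of_map_val_eq {α β γ : Type*} {s : Finset α} {t : Finset β}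
    {f : α → γ} {g : β → γ} (h : s.val.map f = t.val.map g) :
    ∃ σ : s ≃ t, ∀ x, g (σ x) = f x := by
  have key : ∀ c, Nonempty ({x : s // f x = c} ≃ {y : t // g y = c}) := by
    intro c
    rw [← Fintype.card_eq]
    have h1 := congrArg (Multiset.count c) h
    rw [Multiset.count_map, Multiset.count_map] at h1
    have e1 : Fintype.card {x : s // f x = c} = (Multiset.filter (fun a => c = f a) s.val).card := by
      rw [Fintype.card_subtype, ← Finset.filter_val, Finset.card_val,
        Finset.univ_eq_attach, ← Finset.card_map (Function.Embedding.subtype _)]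
      congr 1
      ext x
      simp [eq_comm, and_comm]
    have e2 : Fintype.card {y : t // g y = c} = (Multiset.filter (fun a => c = g a) t.val).card := by
      rw [Fintype.card_subtype, ← Finset.filter_val, Finset.card_val,
        Finset.univ_eq_attach, ← Finset.card_map (Function.Embedding.subtype _)]
      congr 1
      ext x
      simp [eq_comm, and_comm]
    rw [e1, e2, h1]
  have k := fun c => (key c).some
  refine ⟨(Equiv.sigmaFiberEquiv (fun x : s => f x)).symm.trans
    ((Equiv.sigmaCongrRight k).trans (Equiv.sigmaFiberEquiv (fun y : t => g y))), fun x => ?_⟩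
  exact (k (f x) ⟨x, rfl⟩).2

theorem Finset.map_val_eq_of_equiv {α β γ : Type*} {s : Finset α} {t : Finset β}
    {f : α → γ} {g : β → γ} (σ : s ≃ t) (h : ∀ x, g (σ x) = f x) :
    s.val.map f = t.val.map g := by
  refine Multiset.map_eq_map_of_bij_of_nodup f g s.nodup t.nodup
    (fun a ha => (σ ⟨a, ha⟩ : β)) (fun a ha => (σ ⟨a, ha⟩).2) ?_ ?_ ?_
  · intro a ha b hb hab
    simpa using σ.injective (Subtype.ext hab)
  · intro b hb
    exact ⟨σ.symm ⟨b, hb⟩, (σ.symm ⟨b, hb⟩).2, by simp⟩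
  · intro a ha
    exact (h ⟨a, ha⟩).symm

-- The prescribed pair can be enforced by composing with a transposition of two points of equal
-- colour.
open Classical in
theorem Finset.exists_pointed_equiv_of_map_val_eq {α β γ : Type*} {s : Finset α} {t : Finset β}
    {f : α → γ} {g : β → γ} (h : s.val.map f = t.val.map g) (a : s) (b : t)
    (hab : f a = g b) :
    ∃ σ : s ≃ t, σ a = b ∧ ∀ x, g (σ x) = f x := by
  obtain ⟨σ, hσ⟩ := Finset.exists_equiv_of_map_val_eq h
  refine ⟨σ.trans (Equiv.swap (σ a) b), by simp, fun x => ?_⟩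
  simp only [Equiv.trans_apply, Equiv.swap_apply_def]
  split_ifs with h1 h2
  · rw [← hab, σ.injective h1]
  · rw [hσ, hab, ← h2, hσ]
  · exact hσ x

/-! ### Rooting connected Berge-acyclic hypergraphs -/

namespace SimpleGraph

/-- The parent of `x` is the second vertex on the path from `x` to `r`. For adjacent `x` and `y`,
either `y` lies on the path of `x` and is then its second vertex, or prepending `y` gives the unique
path of `y`. -/
theorem IsTree.exists_parent {X : Type*} {g : SimpleGraph X} (hg : g.IsTree) (r : X) :
    ∃ p : X → X, (∀ x, x ≠ r → g.Adj x (p x) ∧ g.dist (p x) r < g.dist x r) ∧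
      ∀ x y, g.Adj x y → (x ≠ r ∧ y = p x) ∨ (y ≠ r ∧ x = p y) := by
  classical
  choose q hq hlen using fun x => hg.connected.exists_path_of_dist x r
  refine ⟨fun x => (q x).snd, fun x hx => ⟨(q x).adj_snd (Walk.not_nil_of_ne hx), ?_⟩, ?_⟩
  · have h1 := Walk.length_tail_add_one (Walk.not_nil_of_ne (p := q x) hx)
    have h2 := dist_le (q x).tail
    rw [← hlen x]
    change g.dist (q x).snd r < _
    omega
  · intro x y hxy
    by_cases hy : y ∈ (q x).support
    · left
      have hxr : x ≠ r := by
        rintro rfl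
        rw [(Walk.isPath_iff_nil.1 (hq x)).eq_nil, Walk.support_nil, List.mem_singleton] at hy
        exact hxy.ne' hy
      exact ⟨hxr, hg.isAcyclic.eq_snd_of_adj_start (hq x) hxy hy⟩
    · right
      have hyr : y ≠ r := by
        rintro rfl
        exact hy (q x).end_mem_support
      refine ⟨hyr, ?_⟩
      have hp : (Walk.cons hxy.symm (q x)).IsPath := (hq x).cons hy
      have := Subtype.mk.inj ((hg.isAcyclic.subsingleton_path y r).elim ⟨_, hq y⟩ ⟨_, hp⟩)
      change x = (q y).snd
      rw [this, Walk.snd_cons]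

end SimpleGraph

namespace MultiHypergraph

/-- A description of a hypergraph as a tree growing out of `root`: every edge `d` consists of its
parent vertex `parE d` and the vertices whose parent edge `parV` is `d`. -/
structure Rooting {W D : Type*} (B : MultiHypergraph W D) where
  root : W
  parE : D → W
  parV : W → Option D
  rank : W → ℕ
  mem_inc_iff : ∀ w d, w ∈ B.inc d ↔ w = parE d ∨ parV w = some d
  parV_eq_none_iff : ∀ w, parV w = none ↔ w = root
  rank_parE_lt : ∀ w d, parV w = some d → rank (parE d) < rank w

theorem exists_rooting {W D : Type*} (B : MultiHypergraph W D) (hc : B.IsConnected)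
    (ha : B.IsBergeAcyclic) : Nonempty B.Rooting := by
  classical
  have hr : Nonempty W := by
    obtain ⟨w | d⟩ := hc.nonempty
    · exact ⟨w⟩
    · exact ⟨(B.inc_nonempty d).choose⟩
  obtain ⟨r⟩ := hr
  obtain ⟨p, hp, hadj⟩ := SimpleGraph.IsTree.exists_parent (g := B.incGraph) ⟨hc, ha⟩ (.inl r)
  have hE : ∀ d : D, ∃ w, p (.inr d) = .inl w := by
    intro d
    have h := (hp (.inr d) (by simp)).1
    rcases hpd : p (.inr d) with w | d'
    · exact ⟨w, rfl⟩
    · rw [hpd] at h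
      exact h.elim
  have hV : ∀ w : W, w ≠ r → ∃ d, p (.inl w) = .inr d := by
    intro w hw
    have h := (hp (.inl w) (by simpa using hw)).1
    rcases hpd : p (.inl w) with w' | d
    · rw [hpd] at h
      exact h.elim
    · exact ⟨d, rfl⟩
  choose pE hpE using hE
  choose pV hpV using hV
  have hsome : ∀ w d, (if h : w = r then none else some (pV w h)) = some d ↔
      w ≠ r ∧ p (.inl w) = .inr d := by
    intro w d
    by_cases hw : w = r
    · simp [hw]
    · simp [hw, hpV w hw]
  refine ⟨⟨r, pE, fun w => if h : w = r then none else some (pV w h),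
    fun w => B.incGraph.dist (.inl w) (.inl r), ?_, ?_, ?_⟩⟩
  · intro w d
    rw [hsome]
    constructor
    · intro h
      rcases hadj (.inl w) (.inr d) h with ⟨h1, h2⟩ | ⟨h1, h2⟩
      · exact Or.inr ⟨by simpa using h1, h2.symm⟩
      · rw [hpE] at h2
        exact Or.inl (Sum.inl_injective h2)
    · rintro (rfl | ⟨h1, h2⟩)
      · have h := (hp (.inr d) (by simp)).1
        rw [hpE] at h
        exact h
      · have h := (hp (.inl w) (by simpa using h1)).1
        rw [h2] at h
        exact h
  · intro w
    by_cases hw : w = r <;> simp [hw]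
  · intro w d h
    rw [hsome] at h
    have h1 := (hp (.inl w) (by simpa using h.1)).2
    have h2 := (hp (.inr d) (by simp)).2
    rw [h.2] at h1
    rw [hpE] at h2
    exact h2.trans h1

namespace Rooting

variable {W D : Type*} {B : MultiHypergraph W D}

theorem parE_mem (ρ : B.Rooting) (d : D) : ρ.parE d ∈ B.inc d := (ρ.mem_inc_iff _ _).2 (Or.inl rfl)

theorem mem_inc_of_parV_eq (ρ : B.Rooting) {w : W} {d : D} (h : ρ.parV w = some d) : w ∈ B.inc d :=
  (ρ.mem_inc_iff _ _).2 (Or.inr h)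

theorem rank_induction (ρ : B.Rooting) {P : W → Prop} (root : P ρ.root)
    (step : ∀ w d, ρ.parV w = some d → P (ρ.parE d) → P w) (w : W) : P w := by
  induction h : ρ.rank w using Nat.strong_induction_on generalizing w with
  | _ n ih =>
    rcases hw : ρ.parV w with _ | d
    · rw [ρ.parV_eq_none_iff] at hw
      exact hw ▸ root
    · exact step w d hw (ih _ (h ▸ ρ.rank_parE_lt w d hw) _ rfl)

theorem isConnected (ρ : B.Rooting) : B.IsConnected := by
  have hV : ∀ w, B.incGraph.Reachable (.inl ρ.root) (.inl w) := by
    refine ρ.rank_induction (P := fun w => B.incGraph.Reachable (.inl ρ.root) (.inl w)) ?_ ?_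
    · exact SimpleGraph.Reachable.refl _
    · intro w d h ih
      have h1 : B.incGraph.Adj (.inl (ρ.parE d)) (.inr d) := ρ.parE_mem d
      have h2 : B.incGraph.Adj (.inr d) (.inl w) := ρ.mem_inc_of_parV_eq h
      exact (ih.trans h1.reachable).trans h2.reachable
  refine (SimpleGraph.connected_iff_exists_forall_reachable _).2 ⟨.inl ρ.root, ?_⟩
  rintro (w | d)
  · exact hV w
  · have h1 : B.incGraph.Adj (.inl (ρ.parE d)) (.inr d) := ρ.parE_mem d
    exact (hV _).trans h1.reachable

/-- Each edge of the incidence graph joins some non-root node to its parent, so there are fewer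
edges than nodes; a connected graph with this property is a tree. -/
theorem isBergeAcyclic (ρ : B.Rooting) [Finite W] [Finite D] : B.IsBergeAcyclic := by
  classical
  have hfin : Finite B.incGraph.edgeSet := inferInstance
  refine (SimpleGraph.isTree_iff_connected_and_card.2 ⟨ρ.isConnected, ?_⟩).isAcyclic
  refine le_antisymm ?_ ρ.isConnected.card_vert_le_card_edgeSet_add_one
  have hmem : ∀ e ∈ B.incGraph.edgeSet, ∃ x : {x : W ⊕ D // x ≠ .inl ρ.root},
      e = (match x.1 with
        -- The loop is a junk value for the root, which the subtype excludes.
        | .inl w => (ρ.parV w).elim s(.inl w, .inl w) (fun d => s(.inl w, .inr d))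
        | .inr d => s(.inl (ρ.parE d), .inr d)) := by
    have aux : ∀ w d, w ∈ B.inc d → ∃ x : {x : W ⊕ D // x ≠ .inl ρ.root},
      (s(.inl w, .inr d) : Sym2 (W ⊕ D)) = (match x.1 with
        | .inl w => (ρ.parV w).elim s(.inl w, .inl w) (fun d => s(.inl w, .inr d))
        | .inr d => s(.inl (ρ.parE d), .inr d)) := by
      intro w d h
      rcases (ρ.mem_inc_iff w d).1 h with rfl | h
      · exact ⟨⟨.inr d, by simp⟩, rfl⟩
      · refine ⟨⟨.inl w, ?_⟩, ?_⟩
        · intro hw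
          rw [(ρ.parV_eq_none_iff w).2 (Sum.inl_injective hw)] at h
          simp at h
        · simp [h]
    intro e
    induction e using Sym2.ind with
    | _ x y =>
      intro h
      rcases x with w | d <;> rcases y with w' | d'
      · exact h.elim
      · exact aux w d' h
      · rw [Sym2.eq_swap]
        exact aux w' d h
      · exact h.elim
  choose k hk using hmem
  have hinj : Function.Injective (fun e : B.incGraph.edgeSet => k e.1 e.2) := by
    intro e e' h
    ext1
    rw [hk e.1 e.2, hk e'.1 e'.2]
    simp only at h
    rw [h]
  have h1 := Nat.card_le_card_of_injective _ hinj
  have h2 : Nat.card {x : W ⊕ D // x ≠ .inl ρ.root} + 1 = Nat.card (W ⊕ D) := by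
    have := Fintype.ofFinite W
    have := Fintype.ofFinite D
    rw [Nat.card_eq_fintype_card, Nat.card_eq_fintype_card, Fintype.card_subtype_compl,
      Fintype.card_subtype_eq]
    have : 0 < Fintype.card (W ⊕ D) := Fintype.card_pos_iff.2 ⟨.inl ρ.root⟩
    omega
  omega

end Rooting

end MultiHypergraph

/-! ### Homomorphisms and rooted counts -/

namespace MultiHypergraph

section Hom

variable {W D V E V' E' : Type*} {B : MultiHypergraph W D} {G : MultiHypergraph V E}
  {H : MultiHypergraph V' E'}

theorem Hom.ext' {h k : Hom B G} (hV : h.onV = k.onV) (hE : h.onE = k.onE) : h = k := by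
  cases h; cases k; congr

theorem Hom.onV_mem (h : Hom B G) {w : W} {d : D} (hw : w ∈ B.inc d) :
    h.onV w ∈ G.inc (h.onE d) := by
  rw [← Finset.mem_coe, ← h.image_inc]
  exact ⟨w, hw, rfl⟩

instance [Finite W] [Finite D] [Finite V] [Finite E] : Finite (Hom B G) :=
  Finite.of_injective (fun h : Hom B G => (h.onV, h.onE))
    fun _ _ hk => Hom.ext' (congrArg Prod.fst hk) (congrArg Prod.snd hk)

/-- Composition of homomorphisms. -/
def Hom.comp (k : Hom G H) (h : Hom B G) : Hom B H where
  onV := k.onV ∘ h.onV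
  onE := k.onE ∘ h.onE
  image_inc e := by rw [Set.image_comp, h.image_inc, k.image_inc]; rfl

/-- The number of homomorphisms from `B` to `G` that map the vertex `r` to `v`. -/
noncomputable def rootedHomCount (B : MultiHypergraph W D) (r : W) (G : MultiHypergraph V E)
    (v : V) : ℕ :=
  Nat.card {h : Hom B G // h.onV r = v}

theorem homCount_eq_sum_rootedHomCount [Finite W] [Finite D] [Fintype V] [Finite E] (r : W) :
    B.homCount G = ∑ v, B.rootedHomCount r G v := by
  unfold homCount rootedHomCount
  rw [← Nat.card_sigma]
  exact Nat.card_congr (Equiv.sigmaFiberEquiv fun h : Hom B G => h.onV r).symm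

end Hom

/-- The colour in the previous round, computed from the colour in the current round. -/
def Color.prev : (i : ℕ) → Color (i + 1) → Color i
  | 0, _ => ()
  | i + 1, c => Multiset.map (Multiset.map (Color.prev i)) c

/-! ### Matching the neighbourhoods of vertices of equal colour -/

section Color

variable {V E V' E' : Type*} [Fintype E] [Fintype E'] {G : MultiHypergraph V E}
  {H : MultiHypergraph V' E'}

open Classical in
theorem color_succ (G : MultiHypergraph V E) (i : ℕ) (v : V) :
    G.color (i + 1) v = (Finset.univ.filter (fun e : E => v ∈ G.inc e)).val.map
        (fun e => (G.inc e).val.map (G.color i)) := rfl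

theorem prev_color (i : ℕ) (v : V) : Color.prev i (G.color (i + 1) v) = G.color i v := by
  induction i generalizing v with
  | zero => rfl
  | succ i ih =>
    rw [color_succ G i v, color_succ G (i + 1) v]
    change Multiset.map (Multiset.map (Color.prev i)) _ = _
    rw [Multiset.map_map]
    refine Multiset.map_congr rfl fun e _ => ?_
    rw [Function.comp_apply, Multiset.map_map]
    exact Multiset.map_congr rfl fun u _ => ih u

theorem color_eq_of_le {v : V} {w : V'} {i j : ℕ} (hij : i ≤ j)
    (h : G.color j v = H.color j w) : G.color i v = H.color i w := by
  induction hij with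
  | refl => exact h
  | step _ ih => exact ih (by rw [← prev_color, h, prev_color])

/-- One level of the transport. The map `sV` is chosen before the colour hypothesis and is total in
the edge, so that it can be iterated along a tree without carrying proofs. -/
theorem exists_local_embedding (G : MultiHypergraph V E) (H : MultiHypergraph V' E') (j : ℕ)
    (v : V) (w : V') :
    ∃ sV : E → V → V', G.color (j + 1) v = H.color (j + 1) w →
      ∃ sE : {e // v ∈ G.inc e} → E', Function.Injective sE ∧
        ∀ e : {e // v ∈ G.inc e}, sV e '' (G.inc e : Set V) = (H.inc (sE e) : Set V') ∧
          sV e v = w ∧ Set.InjOn (sV e) (G.inc e : Set V) ∧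
          ∀ u ∈ G.inc e, G.color j u = H.color j (sV e u) := by
  classical
  by_cases hc : G.color (j + 1) v = H.color (j + 1) w
  swap
  · exact ⟨fun _ _ => w, fun h => (hc h).elim⟩
  have hc' := color_eq_of_le (Nat.le_succ j) hc
  rw [color_succ, color_succ] at hc
  obtain ⟨σ, hσ⟩ := Finset.exists_equiv_of_map_val_eq hc
  have hv : ∀ e, v ∈ G.inc e → e ∈ Finset.univ.filter (fun e : E => v ∈ G.inc e) := by simp
  have hw : ∀ e ∈ Finset.univ.filter (fun e : E' => w ∈ H.inc e), w ∈ H.inc e := by simp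
  -- Matched edges have equal multisets of round-`j` colours, and `v`, `w` agree in round `j`, so
  -- the bijection can be taken to send `v` to `w`.
  choose τ hτ1 hτ2 using fun e : {e // v ∈ G.inc e} =>
    Finset.exists_pointed_equiv_of_map_val_eq (hσ ⟨e, hv e e.2⟩).symm ⟨v, e.2⟩
      ⟨w, hw _ (σ ⟨e, hv e e.2⟩).2⟩ hc'
  refine ⟨fun e u => if h : v ∈ G.inc e ∧ u ∈ G.inc e then (τ ⟨e, h.1⟩ ⟨u, h.2⟩ : V') else w,
    fun _ => ⟨fun e => (σ ⟨e, hv e e.2⟩ : E'), ?_, ?_⟩⟩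
  · intro e e' h
    have := σ.injective (Subtype.ext h)
    exact Subtype.ext (Subtype.mk.inj this)
  · rintro ⟨e, he⟩
    have happ : ∀ u (hu : u ∈ G.inc e), (if h : v ∈ G.inc e ∧ u ∈ G.inc e then
        (τ ⟨e, h.1⟩ ⟨u, h.2⟩ : V') else w) = τ ⟨e, he⟩ ⟨u, hu⟩ := fun u hu => dif_pos ⟨he, hu⟩
    refine ⟨?_, ?_, ?_, ?_⟩
    · ext y
      constructor
      · rintro ⟨u, hu, rfl⟩
        simp only
        rw [happ u hu]
        exact (τ ⟨e, he⟩ ⟨u, hu⟩).2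
      · intro hy
        obtain ⟨⟨u, hu⟩, h⟩ := (τ ⟨e, he⟩).surjective ⟨y, hy⟩
        refine ⟨u, hu, ?_⟩
        simp only
        rw [happ u hu, h]
    · simp only
      rw [happ v he, hτ1]
    · intro u hu u' hu' h
      simp only at h
      rw [happ u hu, happ u' hu'] at h
      exact congrArg Subtype.val ((τ ⟨e, he⟩).injective (Subtype.ext h))
    · intro u hu
      simp only
      rw [happ u hu]
      exact (hτ2 ⟨e, he⟩ ⟨u, hu⟩).symm

end Color

/-! ### Equal colours give equal rooted counts -/

section Transfer

variable {W D V E V' E' : Type*} {B : MultiHypergraph W D}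

/-- Transport a vertex map along a rooted hypergraph: the root is sent to `w₀`, and the image of
every other vertex is computed from the image of the parent vertex of its parent edge. -/
noncomputable def Rooting.transfer (ρ : B.Rooting) (s : ℕ → V → V' → E → V → V') (N : ℕ) (w₀ : V')
    (hV : W → V) (hE : D → E) (x : W) : V' :=
  match h : ρ.parV x with
  | none => w₀
  | some d => s (N - ρ.rank (ρ.parE d) - 1) (hV (ρ.parE d))
      (ρ.transfer s N w₀ hV hE (ρ.parE d)) (hE d) (hV x)
termination_by ρ.rank x
decreasing_by exact ρ.rank_parE_lt x d h

theorem Rooting.transfer_root (ρ : B.Rooting) (s : ℕ → V → V' → E → V → V') (N : ℕ) (w₀ : V')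
    (hV : W → V) (hE : D → E) : ρ.transfer s N w₀ hV hE ρ.root = w₀ := by
  have := (ρ.parV_eq_none_iff ρ.root).2 rfl
  rw [Rooting.transfer]
  split
  · rfl
  · simp_all

theorem Rooting.transfer_of_parV_eq (ρ : B.Rooting) (s : ℕ → V → V' → E → V → V') (N : ℕ)
    (w₀ : V') (hV : W → V) (hE : D → E) {x : W} {d : D} (h : ρ.parV x = some d) :
    ρ.transfer s N w₀ hV hE x = s (N - ρ.rank (ρ.parE d) - 1) (hV (ρ.parE d))
      (ρ.transfer s N w₀ hV hE (ρ.parE d)) (hE d) (hV x) := by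
  rw [Rooting.transfer]
  split
  · simp_all
  · simp_all

variable [Finite W] [Finite D] [Fintype E] [Fintype V'] [Fintype E']

theorem rootedHomCount_le_of_color_eq (ρ : B.Rooting) {G : MultiHypergraph V E}
    {H : MultiHypergraph V' E'} {N : ℕ} (hN : ∀ x, ρ.rank x < N) {v : V} {w : V'}
    (hvw : G.color N v = H.color N w) :
    B.rootedHomCount ρ.root G v ≤ B.rootedHomCount ρ.root H w := by
  choose s hs using exists_local_embedding G H
  choose sE hinj hsE using hs
  let t : Hom B G → W → V' := fun h => ρ.transfer s N w h.onV h.onE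
  have ht0 : ∀ h, t h ρ.root = w := fun h => ρ.transfer_root s N w h.onV h.onE
  have ht : ∀ h x d, ρ.parV x = some d → t h x = s (N - ρ.rank (ρ.parE d) - 1)
      (h.onV (ρ.parE d)) (t h (ρ.parE d)) (h.onE d) (h.onV x) :=
    fun h x d hx => ρ.transfer_of_parV_eq s N w h.onV h.onE hx
  have hsucc : ∀ x, N - ρ.rank x - 1 + 1 = N - ρ.rank x := fun x => by have := hN x; omega
  -- A vertex of rank `r` and its transported image agree in round `N - r`. Matching inside an edge
  -- costs one round, and ranks increase strictly from the parent vertex of an edge to its children.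
  have hcol : ∀ h : Hom B G, h.onV ρ.root = v → ∀ x,
      G.color (N - ρ.rank x) (h.onV x) = H.color (N - ρ.rank x) (t h x) := by
    intro h hr
    refine ρ.rank_induction (P := fun x =>
      G.color (N - ρ.rank x) (h.onV x) = H.color (N - ρ.rank x) (t h x)) ?_ ?_
    · rw [ht0, hr]
      exact color_eq_of_le (Nat.sub_le _ _) hvw
    · intro x d hx ih
      rw [ht h x d hx]
      have hlt := ρ.rank_parE_lt x d hx
      rw [← hsucc] at ih
      have := (hsE _ _ _ ih ⟨h.onE d, h.onV_mem (ρ.parE_mem d)⟩).2.2.2 (h.onV x)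
        (h.onV_mem (ρ.mem_inc_of_parV_eq hx))
      refine color_eq_of_le ?_ this
      omega
  have hcol' : ∀ h : Hom B G, h.onV ρ.root = v → ∀ x,
      G.color (N - ρ.rank x - 1 + 1) (h.onV x) = H.color (N - ρ.rank x - 1 + 1) (t h x) := by
    intro h hr x
    rw [hsucc]
    exact hcol h hr x
  let F : {h : Hom B G // h.onV ρ.root = v} → {h : Hom B H // h.onV ρ.root = w} := fun h =>
    ⟨{  onV := t h.1
        onE := fun d => sE _ _ _ (hcol' h.1 h.2 (ρ.parE d))
          ⟨h.1.onE d, h.1.onV_mem (ρ.parE_mem d)⟩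
        image_inc := by
          intro d
          have hd := hsE _ _ _ (hcol' h.1 h.2 (ρ.parE d))
            ⟨h.1.onE d, h.1.onV_mem (ρ.parE_mem d)⟩
          rw [← hd.1, ← h.1.image_inc, Set.image_image]
          refine Set.image_congr fun x hx => ?_
          rcases (ρ.mem_inc_iff x d).1 hx with rfl | hx
          · exact hd.2.1.symm
          · exact ht _ _ _ hx }, ht0 h.1⟩
  refine Nat.card_le_card_of_injective F ?_
  -- Stated for separate base vertices because the two edges belong to subtypes that coincide only
  -- after substitution.
  have hcancelE : ∀ j v₁ v₂ w₁ w₂ (h₁ : G.color (j + 1) v₁ = H.color (j + 1) w₁)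
      (h₂ : G.color (j + 1) v₂ = H.color (j + 1) w₂) e₁ e₂, v₁ = v₂ → w₁ = w₂ →
      sE j v₁ w₁ h₁ e₁ = sE j v₂ w₂ h₂ e₂ → e₁.1 = e₂.1 := by
    rintro j v₁ _ w₁ _ h₁ h₂ e₁ e₂ rfl rfl h
    rw [hinj _ _ _ _ h]
  intro h k hhk
  have hV : t h.1 = t k.1 := congrArg (fun f => f.1.onV) hhk
  have hE : ∀ d, h.1.onV (ρ.parE d) = k.1.onV (ρ.parE d) → h.1.onE d = k.1.onE d := by
    intro d hd
    have := congrFun (congrArg (fun f => f.1.onE) hhk) d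
    exact hcancelE _ _ _ _ _ _ _ _ _ hd (congrFun hV _) this
  -- The original homomorphism is recovered from the root downwards: equal parent images force equal
  -- edge images, and then the local map is injective on that edge.
  have hV' : ∀ x, h.1.onV x = k.1.onV x := by
    refine ρ.rank_induction (P := fun x => h.1.onV x = k.1.onV x) (h.2.trans k.2.symm) ?_
    intro x d hx ih
    have h1 := congrFun hV x
    rw [ht _ _ _ hx, ht _ _ _ hx, ← hV, ← ih, ← hE d ih] at h1
    refine (hsE _ _ _ (hcol' h.1 h.2 (ρ.parE d)) ⟨h.1.onE d, h.1.onV_mem (ρ.parE_mem d)⟩).2.2.1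
      (h.1.onV_mem (ρ.mem_inc_of_parV_eq hx)) ?_ h1
    change k.1.onV x ∈ G.inc (h.1.onE d)
    rw [hE d ih]
    exact k.1.onV_mem (ρ.mem_inc_of_parV_eq hx)
  exact Subtype.ext (Hom.ext' (funext hV') (funext fun d => hE d (hV' _)))

theorem homCount_eq_of_not_distinguishes [Fintype V] {G : MultiHypergraph V E} {H : MultiHypergraph V' E'}
    (h : ¬ ColorRefinementDistinguishes G H) (hc : B.IsConnected) (ha : B.IsBergeAcyclic) :
    B.homCount G = B.homCount H := by
  classical
  obtain ⟨ρ⟩ := B.exists_rooting hc ha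
  obtain ⟨N, hN⟩ := (Set.finite_range ρ.rank).bddAbove
  have hN' : ∀ x, ρ.rank x < N + 1 := fun x => Nat.lt_succ_of_le (hN ⟨x, rfl⟩)
  unfold ColorRefinementDistinguishes at h
  push Not at h
  obtain ⟨σ, hσ⟩ := Finset.exists_equiv_of_map_val_eq (h (N + 1))
  rw [homCount_eq_sum_rootedHomCount ρ.root, homCount_eq_sum_rootedHomCount ρ.root,
    ← Finset.sum_coe_sort, ← Finset.sum_coe_sort Finset.univ (B.rootedHomCount ρ.root H)]
  refine Fintype.sum_equiv σ _ _ fun x => ?_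
  exact le_antisymm (rootedHomCount_le_of_color_eq ρ hN' (hσ x).symm)
    (rootedHomCount_le_of_color_eq ρ hN' (hσ x))

end Transfer

end MultiHypergraph

/-! ### Explicit rooted trees, gluing and grafting -/

namespace MultiHypergraph

section Congr

variable {W D W' D' V E : Type*}

/-- The copy of a hypergraph along bijections of the vertices and of the edges. -/
def copy (B : MultiHypergraph W D) (eW : W ≃ W') (eD : D ≃ D') : MultiHypergraph W' D' where
  inc d := (B.inc (eD.symm d)).map eW.toEmbedding
  inc_nonempty _ := (B.inc_nonempty _).map

theorem coe_inc_copy (B : MultiHypergraph W D) (eW : W ≃ W') (eD : D ≃ D') (d : D') :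
    ((B.copy eW eD).inc d : Set W') = eW '' (B.inc (eD.symm d) : Set W) := by
  simp [copy]

/-- The copy of a rooting along bijections. -/
def Rooting.copy {B : MultiHypergraph W D} (ρ : B.Rooting) (eW : W ≃ W') (eD : D ≃ D') :
    (B.copy eW eD).Rooting where
  root := eW ρ.root
  parE d := eW (ρ.parE (eD.symm d))
  parV w := (ρ.parV (eW.symm w)).map eD
  rank w := ρ.rank (eW.symm w)
  mem_inc_iff w d := by
    have h : w ∈ (B.copy eW eD).inc d ↔ eW.symm w ∈ B.inc (eD.symm d) := by
      rw [← Finset.mem_coe, coe_inc_copy, Equiv.image_eq_preimage_symm]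
      rfl
    rw [h, ρ.mem_inc_iff, Equiv.symm_apply_eq]
    refine or_congr Iff.rfl ?_
    rw [Option.map_eq_some_iff]
    constructor
    · intro h
      exact ⟨_, h, by simp⟩
    · rintro ⟨a, ha, rfl⟩
      simpa using ha
  parV_eq_none_iff w := by
    rw [Option.map_eq_none_iff, ρ.parV_eq_none_iff, Equiv.symm_apply_eq]
  rank_parE_lt w d h := by
    rw [Option.map_eq_some_iff] at h
    obtain ⟨a, ha, rfl⟩ := h
    simpa using ρ.rank_parE_lt _ _ ha

theorem homCount_copy (B : MultiHypergraph W D) (eW : W ≃ W') (eD : D ≃ D')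
    (G : MultiHypergraph V E) : (B.copy eW eD).homCount G = B.homCount G := by
  refine Nat.card_congr ⟨fun h => ⟨h.onV ∘ eW, h.onE ∘ eD, fun d => ?_⟩,
    fun h => ⟨h.onV ∘ eW.symm, h.onE ∘ eD.symm, fun d => ?_⟩, fun h => ?_, fun h => ?_⟩
  · have := h.image_inc (eD d)
    rw [coe_inc_copy, Equiv.symm_apply_apply, ← Set.image_comp] at this
    exact this
  · have := h.image_inc (eD.symm d)
    rw [coe_inc_copy, ← Set.image_comp, Function.comp_assoc, Equiv.symm_comp_self]
    exact this
  · apply Hom.ext' <;> ext <;> simp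
  · apply Hom.ext' <;> ext <;> simp

end Congr

/-- A presentation of a rooted connected Berge-acyclic hypergraph with vertex set `Option N` and
root `none`. -/
structure TreeCode where
  N : Type
  D : Type
  [finN : Finite N]
  [finD : Finite D]
  parE : D → Option N
  parV : N → D
  rank : Option N → ℕ
  rank_lt : ∀ n, rank (parE (parV n)) < rank (some n)

namespace TreeCode

instance (T : TreeCode) : Finite T.N := T.finN
instance (T : TreeCode) : Finite T.D := T.finD

/-- The hypergraph presented by a tree code. -/
noncomputable def hypergraph (T : TreeCode) : MultiHypergraph (Option T.N) T.D where
  inc d := (Set.toFinite {x : Option T.N | x = T.parE d ∨ x.map T.parV = some d}).toFinset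
  inc_nonempty d := ⟨T.parE d, by simp⟩

theorem mem_inc_hypergraph (T : TreeCode) (x : Option T.N) (d : T.D) :
    x ∈ T.hypergraph.inc d ↔ x = T.parE d ∨ x.map T.parV = some d := by
  simp [hypergraph]

theorem coe_inc_hypergraph (T : TreeCode) (d : T.D) :
    (T.hypergraph.inc d : Set (Option T.N)) = insert (T.parE d) (some '' {n | T.parV n = d}) := by
  ext x
  rw [Finset.mem_coe, mem_inc_hypergraph]
  cases x <;> simp

/-- The rooting of the hypergraph presented by a tree code. -/
def rooting (T : TreeCode) : T.hypergraph.Rooting where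
  root := none
  parE := T.parE
  parV x := x.map T.parV
  rank := T.rank
  mem_inc_iff := T.mem_inc_hypergraph
  parV_eq_none_iff := by simp
  rank_parE_lt := by
    rintro (_ | n) d h
    · simp at h
    · obtain rfl : T.parV n = d := by simpa using h
      exact T.rank_lt n

section Count

variable {V E V' E' : Type*}

/-- The number of homomorphisms from the tree to `G` that map the root to `v`. -/
noncomputable def count (T : TreeCode) (G : MultiHypergraph V E) (v : V) : ℕ :=
  T.hypergraph.rootedHomCount none G v

theorem sum_count_eq [Fintype V] [Finite E] [Fintype V'] [Finite E'] (G : MultiHypergraph V E)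
    (H : MultiHypergraph V' E')
    (h : ∀ (W D : Type*) [Finite W] [Finite D] (B : MultiHypergraph W D),
      B.IsConnected → B.IsBergeAcyclic → B.homCount G = B.homCount H) (T : TreeCode) :
    ∑ v, T.count G v = ∑ w, T.count H w := by
  -- Tree codes live in `Type`, so they are lifted to the universes in which the hypothesis is
  -- stated.
  have ρ := T.rooting.copy Equiv.ulift.symm Equiv.ulift.symm
  have := h _ _ _ ρ.isConnected ρ.isBergeAcyclic
  rw [homCount_copy, homCount_copy, homCount_eq_sum_rootedHomCount none,
    homCount_eq_sum_rootedHomCount none] at this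
  exact this

/-- The tree with a single vertex. -/
def single : TreeCode where
  N := Empty
  D := Empty
  parE := Empty.elim
  parV := Empty.elim
  rank _ := 0
  rank_lt n := n.elim

theorem count_single (G : MultiHypergraph V E) (v : V) : single.count G v = 1 := by
  refine Nat.card_eq_one_iff_unique.2 ⟨⟨fun h k => ?_⟩,
    ⟨⟨fun _ => v, Empty.elim, fun e => e.elim⟩, rfl⟩⟩
  refine Subtype.ext (Hom.ext' (funext fun x => ?_) (funext fun e => e.elim))
  rcases x with _ | x
  · exact h.2.trans k.2.symm
  · exact x.elim

/-- Two trees glued at their roots. -/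
abbrev glue (S T : TreeCode) : TreeCode where
  N := S.N ⊕ T.N
  D := S.D ⊕ T.D
  parE := Sum.elim (fun d => (S.parE d).map Sum.inl) (fun d => (T.parE d).map Sum.inr)
  parV := Sum.map S.parV T.parV
  rank
    -- The two roots may have different ranks; shifting all other vertices by the maximum keeps them
    -- above the common root.
    | none => max (S.rank none) (T.rank none)
    | some (.inl n) => max (S.rank none) (T.rank none) + S.rank (some n) + 1
    | some (.inr n) => max (S.rank none) (T.rank none) + T.rank (some n) + 1
  rank_lt := by
    rintro (n | n)
    · have := S.rank_lt n
      simp only [Sum.map_inl, Sum.elim_inl]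
      rcases h : S.parE (S.parV n) with _ | m <;> rw [h] at this <;> simp only [Option.map_none, Option.map_some] <;> omega
    · have := T.rank_lt n
      simp only [Sum.map_inr, Sum.elim_inr]
      rcases h : T.parE (T.parV n) with _ | m <;> rw [h] at this <;> simp only [Option.map_none, Option.map_some] <;> omega

/-- The inclusion of the left part of a glued tree. -/
def glueInl (S T : TreeCode) : Hom S.hypergraph (S.glue T).hypergraph where
  onV := Option.map Sum.inl
  onE := Sum.inl
  image_inc d := by
    rw [coe_inc_hypergraph, coe_inc_hypergraph, Set.image_insert_eq]
    congr 1
    ext x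
    constructor
    · rintro ⟨_, ⟨n, rfl, rfl⟩, rfl⟩
      exact ⟨.inl n, rfl, rfl⟩
    · rintro ⟨n | n, h, rfl⟩
      · exact ⟨some n, ⟨n, Sum.inl_injective h, rfl⟩, rfl⟩
      · simp [glue] at h

/-- The inclusion of the right part of a glued tree. -/
def glueInr (S T : TreeCode) : Hom T.hypergraph (S.glue T).hypergraph where
  onV := Option.map Sum.inr
  onE := Sum.inr
  image_inc d := by
    rw [coe_inc_hypergraph, coe_inc_hypergraph, Set.image_insert_eq]
    congr 1
    ext x
    constructor
    · rintro ⟨_, ⟨n, rfl, rfl⟩, rfl⟩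
      exact ⟨.inr n, rfl, rfl⟩
    · rintro ⟨n | n, h, rfl⟩
      · simp [glue] at h
      · exact ⟨some n, ⟨n, Sum.inr_injective h, rfl⟩, rfl⟩

/-- The two parts share only the root, whose image is prescribed, so their homomorphisms are chosen
independently. -/
theorem count_glue (S T : TreeCode) (G : MultiHypergraph V E) (v : V) :
    (S.glue T).count G v = S.count G v * T.count G v := by
  unfold count rootedHomCount
  rw [← Nat.card_prod]
  refine Nat.card_congr ⟨fun h => (⟨h.1.comp (glueInl S T), h.2⟩, ⟨h.1.comp (glueInr S T), h.2⟩),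
    fun p => ⟨⟨fun x => x.elim v (Sum.elim (fun n => p.1.1.onV (some n))
      (fun n => p.2.1.onV (some n))), Sum.elim p.1.1.onE p.2.1.onE, ?_⟩, rfl⟩, ?_, ?_⟩
  · rintro (d | d)
    · have h : ∀ x, (fun x : Option (S.N ⊕ T.N) => x.elim v (Sum.elim
          (fun n => p.1.1.onV (some n)) (fun n => p.2.1.onV (some n)))) ((glueInl S T).onV x)
          = p.1.1.onV x := by
        rintro (_ | n)
        · exact p.1.2.symm
        · rfl
      have h1 := (glueInl S T).image_inc d
      change _ = ((S.glue T).hypergraph.inc (Sum.inl d) : Set (Option (S.glue T).N)) at h1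
      rw [← h1, Set.image_image, Set.image_congr fun x _ => h x]
      exact p.1.1.image_inc d
    · have h : ∀ x, (fun x : Option (S.N ⊕ T.N) => x.elim v (Sum.elim
          (fun n => p.1.1.onV (some n)) (fun n => p.2.1.onV (some n)))) ((glueInr S T).onV x)
          = p.2.1.onV x := by
        rintro (_ | n)
        · exact p.2.2.symm
        · rfl
      have h1 := (glueInr S T).image_inc d
      change _ = ((S.glue T).hypergraph.inc (Sum.inr d) : Set (Option (S.glue T).N)) at h1
      rw [← h1, Set.image_image, Set.image_congr fun x _ => h x]
      exact p.2.1.image_inc d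
  · intro h
    refine Subtype.ext (Hom.ext' (funext ?_) (funext ?_))
    · rintro (_ | n | n)
      · exact h.2.symm
      · rfl
      · rfl
    · rintro (d | d) <;> rfl
  · rintro ⟨h, k⟩
    refine Prod.ext (Subtype.ext (Hom.ext' (funext ?_) rfl))
      (Subtype.ext (Hom.ext' (funext ?_) rfl))
    · rintro (_ | n)
      · exact h.2.symm
      · rfl
    · rintro (_ | n)
      · exact k.2.symm
      · rfl

/-- The tree whose root lies in exactly one edge, which contains besides it the roots of the
given trees. -/
abbrev graft {k : ℕ} (T : Fin k → TreeCode) : TreeCode where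
  N := Σ j, Option (T j).N
  D := Option (Σ j, (T j).D)
  parE d := d.map fun p => ⟨p.1, (T p.1).parE p.2⟩
  parV n := n.2.map fun m => ⟨n.1, (T n.1).parV m⟩
  rank x := x.elim 0 fun n => (T n.1).rank n.2 + 1
  rank_lt := by
    rintro ⟨j, _ | n⟩
    · simp
    · simpa using (T j).rank_lt n

/-- The inclusion of one of the constituents of a grafted tree. -/
def graftIncl {k : ℕ} (T : Fin k → TreeCode) (j : Fin k) :
    Hom (T j).hypergraph (graft T).hypergraph where
  onV x := some ⟨j, x⟩
  onE d := some ⟨j, d⟩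
  image_inc d := by
    rw [coe_inc_hypergraph, coe_inc_hypergraph, Set.image_insert_eq]
    congr 1
    ext x
    constructor
    · rintro ⟨_, ⟨n, rfl, rfl⟩, rfl⟩
      exact ⟨⟨j, some n⟩, rfl, rfl⟩
    · rintro ⟨⟨i, _ | n⟩, h, rfl⟩
      · simp [graft] at h
      · obtain ⟨rfl, h⟩ : i = j ∧ _ := by simpa [graft] using h
        refine ⟨some n, ⟨n, ?_, rfl⟩, rfl⟩
        simpa using h

theorem coe_inc_graft_none {k : ℕ} (T : Fin k → TreeCode) :
    ((graft T).hypergraph.inc none : Set (Option (graft T).N)) =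
      insert none (Set.range fun j => some ⟨j, none⟩) := by
  rw [coe_inc_hypergraph]
  congr 1
  ext x
  constructor
  · rintro ⟨⟨i, _ | n⟩, h, rfl⟩
    · exact ⟨i, rfl⟩
    · simp [graft] at h
  · rintro ⟨j, rfl⟩
    exact ⟨⟨j, none⟩, rfl, rfl⟩

end Count

end TreeCode

/-- The ways to cover an edge of `G` by `v` and a sequence of `k` vertices. -/
abbrev Cover {V E : Type*} (G : MultiHypergraph V E) (k : ℕ) (v : V) : Type _ :=
  {p : E × (Fin k → V) // insert v (Set.range p.2) = (G.inc p.1 : Set V)}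

namespace TreeCode

-- The new edge and the roots of the constituents may be mapped to any cover of an edge by `v` and
-- `k` further vertices; after that choice the constituents are independent.
open Classical in
theorem count_graft {V E : Type*} [Fintype V] [Fintype E] {k : ℕ} (T : Fin k → TreeCode)
    (G : MultiHypergraph V E) (v : V) :
    (graft T).count G v = ∑ p : G.Cover k v, ∏ j, (T j).count G (p.1.2 j) := by
  unfold count rootedHomCount
  simp_rw [← Nat.card_pi]
  rw [← Nat.card_sigma]
  refine Nat.card_congr ⟨fun h => ⟨⟨(h.1.onE none, fun j => h.1.onV (some ⟨j, none⟩)), ?_⟩,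
    fun j => ⟨h.1.comp (graftIncl T j), rfl⟩⟩,
    fun q => ⟨⟨fun x => x.elim v (fun n => (q.2 n.1).1.onV n.2),
      fun d => d.elim q.1.1.1 (fun n => (q.2 n.1).1.onE n.2), ?_⟩, rfl⟩, ?_, ?_⟩
  · have h1 := h.1.image_inc none
    rw [coe_inc_graft_none, Set.image_insert_eq, h.2, ← Set.range_comp] at h1
    exact h1
  · rintro (_ | ⟨j, d⟩)
    · rw [coe_inc_graft_none, Set.image_insert_eq, ← Set.range_comp]
      have h1 := q.1.2
      simp only [Option.elim_none]
      rw [← h1]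
      congr 2
      funext j
      exact (q.2 j).2
    · have h1 := (graftIncl T j).image_inc d
      change _ = ((graft T).hypergraph.inc (some ⟨j, d⟩) : Set (Option (graft T).N)) at h1
      rw [← h1, Set.image_image]
      exact (q.2 j).1.image_inc d
  · intro h
    refine Subtype.ext (Hom.ext' (funext ?_) (funext ?_))
    · rintro (_ | n)
      · exact h.2.symm
      · rfl
    · rintro (_ | d) <;> rfl
  · rintro ⟨⟨⟨e, s⟩, hs⟩, q⟩
    -- Separating the homomorphisms from their root conditions lets `s` be eliminated, after which
    -- the round trip is definitional.
    obtain ⟨q', hq', rfl⟩ : ∃ (q' : ∀ j, Hom (T j).hypergraph G)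
        (hq' : ∀ j, (q' j).onV none = s j), q = fun j => ⟨q' j, hq' j⟩ := ⟨fun j => (q j).1, fun j => (q j).2, rfl⟩
    obtain rfl : (fun j => (q' j).onV none) = s := funext hq'
    rfl

end TreeCode

end MultiHypergraph

/-! ### Stone-Weierstrass on a finite set -/

-- The span of a monoid of functions is a subalgebra; separation of points gives it the indicator of
-- every point, by Lagrange interpolation.
open Classical in
theorem Submonoid.span_eq_top_of_separates {X : Type*} [Finite X] (M : Submonoid (X → ℚ))
    (h : ∀ x y, x ≠ y → ∃ f ∈ M, f x ≠ f y) : Submodule.span ℚ (M : Set (X → ℚ)) = ⊤ := by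
  have := Fintype.ofFinite X
  have hA : Submodule.span ℚ (M : Set (X → ℚ)) =
      Subalgebra.toSubmodule (Algebra.adjoin ℚ (M : Set (X → ℚ))) := by
    rw [Algebra.adjoin_eq_span, Submonoid.closure_eq]
  have hsingle : ∀ x, (Pi.single x 1 : X → ℚ) ∈ Algebra.adjoin ℚ (M : Set (X → ℚ)) := by
    intro x
    have hf : ∀ y, ∃ f ∈ Algebra.adjoin ℚ (M : Set (X → ℚ)), y ≠ x → f x = 1 ∧ f y = 0 := by
      intro y
      by_cases hy : y = x
      · exact ⟨1, one_mem _, fun h => (h hy).elim⟩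
      · obtain ⟨f, hf, hne⟩ := h x y (Ne.symm hy)
        refine ⟨(f x - f y)⁻¹ • (f - algebraMap ℚ _ (f y)),
          Subalgebra.smul_mem _ (sub_mem (Algebra.subset_adjoin hf) (algebraMap_mem _ _)) _,
          fun _ => ⟨?_, ?_⟩⟩
        · have : f x - f y ≠ 0 := sub_ne_zero.2 hne
          simp [this]
        · simp
    choose f hf hval using hf
    have : (Pi.single x 1 : X → ℚ) = ∏ y ∈ Finset.univ.erase x, f y := by
      funext z
      rw [Finset.prod_apply]
      by_cases hz : z = x
      · subst hz
        rw [Pi.single_eq_same, Finset.prod_eq_one]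
        intro y hy
        exact (hval y (Finset.ne_of_mem_erase hy)).1
      · rw [Pi.single_eq_of_ne hz, Finset.prod_eq_zero (i := z) (by simp [hz])]
        exact (hval z hz).2
    rw [this]
    exact Subalgebra.prod_mem _ fun y _ => hf y
  rw [hA, eq_top_iff]
  intro g _
  have hg : g = ∑ x, g x • (Pi.single x 1 : X → ℚ) := by
    funext z
    simp [Finset.sum_apply, Pi.single_apply]
  rw [hg]
  exact Submodule.sum_mem _ fun x _ => Submodule.smul_mem _ _ (hsingle x)

namespace MultiHypergraph

/-! ### Linear combinations of tree counts -/

section Profile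

variable {V E V' E' : Type*} [Fintype V] [Fintype V']

/-- All rooted tree homomorphism counts at a vertex. -/
noncomputable def profile (G : MultiHypergraph V E) (v : V) (T : TreeCode) : ℕ := T.count G v

/-- Only finitely many profiles occur. On them the counts are closed under products by gluing,
contain `1` by the single-vertex tree, and separate points. The same coefficients serve `G` and `H`,
so identities between counts transfer. -/
theorem exists_profile_coeff (G : MultiHypergraph V E) (H : MultiHypergraph V' E')
    (a : (TreeCode → ℕ) → ℚ) :
    ∃ c : TreeCode →₀ ℚ, (∀ v, a (G.profile v) = ∑ T ∈ c.support, c T * T.count G v) ∧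
      ∀ w, a (H.profile w) = ∑ T ∈ c.support, c T * T.count H w := by
  let X := {q : TreeCode → ℕ // q ∈ Set.range G.profile ∪ Set.range H.profile}
  have : Finite X := ((Set.finite_range G.profile).union (Set.finite_range H.profile)).to_subtype
  let ev : TreeCode → X → ℚ := fun T q => q.1 T
  let M : Submonoid (X → ℚ) :=
    { carrier := Set.range ev
      one_mem' := by
        refine ⟨TreeCode.single, funext ?_⟩
        rintro ⟨_, ⟨v, rfl⟩ | ⟨v, rfl⟩⟩ <;> simp [ev, profile, TreeCode.count_single]
      mul_mem' := by
        rintro _ _ ⟨S, rfl⟩ ⟨T, rfl⟩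
        refine ⟨S.glue T, funext ?_⟩
        rintro ⟨_, ⟨v, rfl⟩ | ⟨v, rfl⟩⟩ <;> simp [ev, profile, TreeCode.count_glue] }
  have hM : Submodule.span ℚ (Set.range ev) = ⊤ := by
    refine M.span_eq_top_of_separates fun x y hxy => ?_
    by_contra! hcon
    refine hxy (Subtype.ext (funext fun T => ?_))
    have := hcon (ev T) ⟨T, rfl⟩
    simp only [ev] at this
    exact_mod_cast this
  have ha : (fun q : X => a q.1) ∈ Submodule.span ℚ (Set.range ev) := hM ▸ Submodule.mem_top
  obtain ⟨c, hc⟩ := Finsupp.mem_span_range_iff_exists_finsupp.1 ha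
  have hq : ∀ q : X, a q.1 = ∑ T ∈ c.support, c T * q.1 T := by
    intro q
    rw [← congrFun hc q, Finsupp.sum, Finset.sum_apply]
    rfl
  exact ⟨c, fun v => hq ⟨_, Or.inl ⟨v, rfl⟩⟩, fun w => hq ⟨_, Or.inr ⟨w, rfl⟩⟩⟩

open Classical in
theorem map_profile_eq {G : MultiHypergraph V E} {H : MultiHypergraph V' E'}
    (h : ∀ T : TreeCode, ∑ v, T.count G v = ∑ w, T.count H w) :
    (Finset.univ : Finset V).val.map G.profile = (Finset.univ : Finset V').val.map H.profile := by
  ext q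
  obtain ⟨c, hG, hH⟩ := exists_profile_coeff G H (fun q' => if q = q' then 1 else 0)
  have key : (∑ v, if q = G.profile v then (1 : ℚ) else 0) =
      ∑ w, if q = H.profile w then (1 : ℚ) else 0 := by
    simp_rw [hG, hH]
    rw [Finset.sum_comm, Finset.sum_comm (s := Finset.univ)]
    refine Finset.sum_congr rfl fun T _ => ?_
    rw [← Finset.mul_sum, ← Finset.mul_sum]
    congr 1
    exact_mod_cast h T
  rw [Finset.sum_boole, Finset.sum_boole] at key
  rw [Multiset.count_map, Multiset.count_map]
  exact_mod_cast key

-- Expanding each factor into tree counts turns the sum over covers into a combination of counts of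
-- grafted trees, which belong to the profile of the base vertex.
open Classical in
theorem sum_cover_prod_eq [Fintype E] [Fintype E'] {G : MultiHypergraph V E}
    {H : MultiHypergraph V' E'} {v : V} {w : V'} (h : G.profile v = H.profile w) {k : ℕ}
    (a : Fin k → (TreeCode → ℕ) → ℚ) :
    ∑ p : G.Cover k v, ∏ j, a j (G.profile (p.1.2 j)) =
      ∑ p : H.Cover k w, ∏ j, a j (H.profile (p.1.2 j)) := by
  choose c hG hH using fun j => exists_profile_coeff G H (a j)
  simp_rw [hG, hH, Finset.prod_univ_sum]
  rw [Finset.sum_comm, Finset.sum_comm (s := Finset.univ)]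
  refine Finset.sum_congr rfl fun T _ => ?_
  simp_rw [Finset.prod_mul_distrib]
  rw [← Finset.mul_sum, ← Finset.mul_sum]
  congr 1
  have := congrFun h (TreeCode.graft T)
  unfold profile at this
  rw [TreeCode.count_graft, TreeCode.count_graft] at this
  exact_mod_cast this

end Profile

/-! ### Recovering edge colours from cover counts -/

section Coloring

variable {V E V' E' Q : Type*}

/-- The number of sequences of vertices with the given colours that together with `v` cover
exactly the edge `e`. -/
noncomputable def coverCount (G : MultiHypergraph V E) (c : V → Q) {k : ℕ} (l : Fin k → Q) (v : V)
    (e : E) : ℕ :=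
  Nat.card {s : Fin k → V // insert v (Set.range s) = (G.inc e : Set V) ∧ ∀ j, c (s j) = l j}

theorem coverCount_le [Finite V'] {G : MultiHypergraph V E} {H : MultiHypergraph V' E'}
    {c : V → Q} {d : V' → Q}
    {k : ℕ} (l : Fin k → Q) {v : V} {w : V'} (hvw : c v = d w) {e : E} {f : E'} (hv : v ∈ G.inc e)
    (hw : w ∈ H.inc f) (hef : (G.inc e).val.map c = (H.inc f).val.map d) :
    G.coverCount c l v e ≤ H.coverCount d l w f := by
  obtain ⟨τ, hτ, hcol⟩ := Finset.exists_pointed_equiv_of_map_val_eq hef ⟨v, hv⟩ ⟨w, hw⟩ hvw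
  have hmem : ∀ s : {s : Fin k → V // insert v (Set.range s) = (G.inc e : Set V) ∧
      ∀ j, c (s j) = l j}, ∀ j, s.1 j ∈ G.inc e := by
    intro s j
    have h : s.1 j ∈ insert v (Set.range s.1) := Or.inr ⟨j, rfl⟩
    rw [s.2.1] at h
    exact h
  refine Nat.card_le_card_of_injective (fun s => ⟨fun j => τ ⟨s.1 j, hmem s j⟩, ?_, ?_⟩) ?_
  · ext y
    constructor
    · rintro (rfl | ⟨j, rfl⟩)
      · exact hw
      · exact (τ _).2
    · intro hy
      obtain ⟨⟨u, hu⟩, h⟩ := τ.surjective ⟨y, hy⟩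
      have hu' := hu
      rw [← Finset.mem_coe, ← s.2.1] at hu'
      rcases hu' with rfl | ⟨j, rfl⟩
      · left
        rw [hτ] at h
        exact (Subtype.mk.inj h).symm
      · right
        exact ⟨j, congrArg Subtype.val h⟩
  · intro j
    exact (hcol _).trans (s.2.2 j)
  · intro s t hst
    refine Subtype.ext (funext fun j => ?_)
    have := congrFun (Subtype.mk.inj hst) j
    exact Subtype.mk.inj (τ.injective (Subtype.ext this))

theorem coverCount_congr [Finite V] [Finite V'] {G : MultiHypergraph V E}
    {H : MultiHypergraph V' E'} {c : V → Q} {d : V' → Q}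
    {k : ℕ} (l : Fin k → Q) {v : V} {w : V'} (hvw : c v = d w) {e : E} {f : E'} (hv : v ∈ G.inc e)
    (hw : w ∈ H.inc f) (hef : (G.inc e).val.map c = (H.inc f).val.map d) :
    G.coverCount c l v e = H.coverCount d l w f :=
  le_antisymm (coverCount_le l hvw hv hw hef) (coverCount_le l hvw.symm hw hv hef.symm)

theorem exists_of_coverCount_ne_zero {G : MultiHypergraph V E} {c : V → Q} {k : ℕ} {l : Fin k → Q}
    {v : V} {e : E} (h : G.coverCount c l v e ≠ 0) :
    ∃ s : Fin k → V, insert v (Set.range s) = (G.inc e : Set V) ∧ ∀ j, c (s j) = l j := by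
  by_contra hcon
  refine h ?_
  have : IsEmpty {s : Fin k → V // insert v (Set.range s) = (G.inc e : Set V) ∧
    ∀ j, c (s j) = l j} := ⟨fun s => hcon ⟨s.1, s.2⟩⟩
  exact Nat.card_of_isEmpty

theorem mem_of_coverCount_ne_zero {G : MultiHypergraph V E} {c : V → Q} {k : ℕ} {l : Fin k → Q}
    {v : V} {e : E} (h : G.coverCount c l v e ≠ 0) : v ∈ G.inc e := by
  obtain ⟨s, hs, -⟩ := exists_of_coverCount_ne_zero h
  rw [← Finset.mem_coe, ← hs]
  exact Set.mem_insert _ _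

-- A sequence of `k + 1` vertices covering more than `k` vertices has no repetition, so it lists the
-- edge exactly.
open Classical in
theorem map_inc_eq_of_coverCount_ne_zero {G : MultiHypergraph V E} {c : V → Q} {k : ℕ}
    {l : Fin k → Q} {v : V} {e : E} (h : G.coverCount c l v e ≠ 0) (hk : k < (G.inc e).card) :
    (G.inc e).val.map c = c v ::ₘ Finset.univ.val.map l := by
  obtain ⟨s, hs, hl⟩ := exists_of_coverCount_ne_zero h
  have hval : (v ::ₘ Finset.univ.val.map s).toFinset = G.inc e := by
    rw [← Finset.coe_inj, ← hs]
    ext x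
    simp
  have hle : (G.inc e).val ≤ v ::ₘ Finset.univ.val.map s := by
    rw [← hval]
    exact Multiset.dedup_le _
  have heq := Multiset.eq_of_le_of_card_le hle (by simpa using hk)
  rw [heq, Multiset.map_cons, Multiset.map_map]
  congr 1
  exact Multiset.map_congr rfl fun j _ => hl j

open Classical in
theorem coverCount_ne_zero [Finite V] {G : MultiHypergraph V E} {c : V → Q} {k : ℕ}
    {l : Fin k → Q} {v : V} {e : E} (hv : v ∈ G.inc e)
    (h : (G.inc e).val.map c = c v ::ₘ Finset.univ.val.map l) : G.coverCount c l v e ≠ 0 := by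
  have hval : (G.inc e).val = v ::ₘ ((G.inc e).erase v).val := by
    rw [Finset.erase_val, Multiset.cons_erase hv]
  rw [hval, Multiset.map_cons, Multiset.cons_inj_right] at h
  obtain ⟨σ, hσ⟩ := Finset.exists_equiv_of_map_val_eq h.symm
  have hne : Nonempty {s : Fin k → V // insert v (Set.range s) = (G.inc e : Set V) ∧
      ∀ j, c (s j) = l j} := by
    refine ⟨fun j => σ ⟨j, Finset.mem_univ j⟩, ?_, fun j => hσ ⟨j, Finset.mem_univ j⟩⟩
    ext x
    constructor
    · rintro (rfl | ⟨j, rfl⟩)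
      · exact hv
      · exact Finset.mem_of_mem_erase (σ _).2
    · intro hx
      by_cases hxv : x = v
      · exact Or.inl hxv
      · obtain ⟨⟨j, hj⟩, h⟩ := σ.surjective ⟨x, Finset.mem_erase.2 ⟨hxv, hx⟩⟩
        exact Or.inr ⟨j, congrArg Subtype.val h⟩
  exact Nat.card_pos.ne'

variable [Fintype E] [Fintype E']

open Classical in
/-- The multiset of the multisets of the colours of the edges containing `v`. -/
noncomputable def edgeColors (G : MultiHypergraph V E) (c : V → Q) (v : V) :
    Multiset (Multiset Q) :=
  (Finset.univ.filter (fun e : E => v ∈ G.inc e)).val.map (fun e => (G.inc e).val.map c)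

-- Edges with more than `k + 1` vertices cannot be covered, and those with exactly `k + 1` only
-- bijectively, which forces their colours. The smaller edges are the error term.
open Classical in
theorem sum_coverCount_eq (G : MultiHypergraph V E) (c : V → Q) {k : ℕ} (l : Fin k → Q) (v : V) :
    ∑ e, G.coverCount c l v e =
      ∑ e with v ∈ G.inc e ∧ (G.inc e).card < k + 1, G.coverCount c l v e +
      ∑ e with v ∈ G.inc e ∧ (G.inc e).val.map c = c v ::ₘ Finset.univ.val.map l,
        G.coverCount c l v e := by
  rw [← Finset.sum_union]
  · symm
    refine Finset.sum_subset (Finset.subset_univ _) fun e _ he => ?_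
    by_contra hne
    have hv := mem_of_coverCount_ne_zero hne
    refine he ?_
    rw [Finset.mem_union, Finset.mem_filter, Finset.mem_filter]
    by_cases hk : k < (G.inc e).card
    · exact Or.inr ⟨Finset.mem_univ _, hv, map_inc_eq_of_coverCount_ne_zero hne hk⟩
    · exact Or.inl ⟨Finset.mem_univ _, hv, by omega⟩
  · rw [Finset.disjoint_filter]
    rintro e _ ⟨_, h1⟩ ⟨_, h2⟩
    have := congrArg Multiset.card h2
    simp at this
    omega

open Classical in
theorem edgeColors_eq [Finite V] [Finite V'] {G : MultiHypergraph V E} {H : MultiHypergraph V' E'}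
    {c : V → Q} {d : V' → Q} {v : V} {w : V'} (hvw : c v = d w)
    (h : ∀ (k : ℕ) (l : Fin k → Q),
      ∑ e, G.coverCount c l v e = ∑ e, H.coverCount d l w e) :
    G.edgeColors c v = H.edgeColors d w := by
  ext m
  -- Multiplicities are compared by size: smaller edges contribute equally by induction, and
  -- cancelling them isolates the edges with colour multiset `m`.
  induction hm : m.card using Nat.strong_induction_on generalizing m with
  | _ n ih =>
  by_cases hmem : c v ∈ m
  swap
  · rw [Multiset.count_eq_zero_of_notMem, Multiset.count_eq_zero_of_notMem]
    · intro hm'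
      obtain ⟨e, he, rfl⟩ := Multiset.mem_map.1 hm'
      rw [hvw] at hmem
      exact hmem (Multiset.mem_map_of_mem d (Finset.mem_filter.1 he).2)
    · intro hm'
      obtain ⟨e, he, rfl⟩ := Multiset.mem_map.1 hm'
      exact hmem (Multiset.mem_map_of_mem c (Finset.mem_filter.1 he).2)
  obtain ⟨m', rfl⟩ := Multiset.exists_cons_of_mem hmem
  obtain ⟨L, rfl⟩ : ∃ L : List Q, (L : Multiset Q) = m' := Quot.exists_rep m'
  obtain ⟨k, l, hl⟩ : ∃ (k : ℕ) (l : Fin k → Q), Finset.univ.val.map l = (L : Multiset Q) :=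
    ⟨L.length, L.get, by simp [Fin.univ_val_map]⟩
  rw [← hl] at hm ⊢
  have hn : k + 1 = n := by simpa using hm
  have hsum := h k l
  rw [sum_coverCount_eq, sum_coverCount_eq, ← hvw] at hsum
  have hlow : ∑ e with v ∈ G.inc e ∧ (G.inc e).card < k + 1, G.coverCount c l v e =
      ∑ e with w ∈ H.inc e ∧ (H.inc e).card < k + 1, H.coverCount d l w e := by
    have hmap : (Finset.univ.filter (fun e : E => v ∈ G.inc e ∧ (G.inc e).card < k + 1)).val.map
          (fun e => (G.inc e).val.map c) =
        (Finset.univ.filter (fun e : E' => w ∈ H.inc e ∧ (H.inc e).card < k + 1)).val.map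
          (fun e => (H.inc e).val.map d) := by
      have hG : (Finset.univ.filter (fun e : E => v ∈ G.inc e ∧ (G.inc e).card < k + 1)).val.map
          (fun e => (G.inc e).val.map c) = (G.edgeColors c v).filter (fun m => m.card < k + 1) := by
        rw [edgeColors, Multiset.filter_map, ← Finset.filter_val, Finset.filter_filter]
        simp
      have hH : (Finset.univ.filter (fun e : E' => w ∈ H.inc e ∧ (H.inc e).card < k + 1)).val.map
          (fun e => (H.inc e).val.map d) = (H.edgeColors d w).filter (fun m => m.card < k + 1) := by
        rw [edgeColors, Multiset.filter_map, ← Finset.filter_val, Finset.filter_filter]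
        simp
      rw [hG, hH]
      ext m
      rw [Multiset.count_filter, Multiset.count_filter]
      split_ifs with hlt
      · exact ih m.card (hn ▸ hlt) m rfl
      · rfl
    obtain ⟨σ, hσ⟩ := Finset.exists_equiv_of_map_val_eq hmap
    rw [← Finset.sum_coe_sort, ← Finset.sum_coe_sort (Finset.univ.filter fun e : E' => _)]
    refine Fintype.sum_equiv σ _ _ fun e => ?_
    exact coverCount_congr l hvw (Finset.mem_filter.1 e.2).2.1
      (Finset.mem_filter.1 (σ e).2).2.1 (hσ e).symm
  rw [hlow] at hsum
  have htop := Nat.add_left_cancel hsum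
  -- All edges with this colour multiset have the same non-zero cover count, in `G` and in `H`, so
  -- dividing by it compares their numbers. If there are none, any non-zero `C` will do.
  have hconst : ∃ C, C ≠ 0 ∧
      (∀ e, v ∈ G.inc e ∧ (G.inc e).val.map c = c v ::ₘ Finset.univ.val.map l →
        G.coverCount c l v e = C) ∧
      (∀ e, w ∈ H.inc e ∧ (H.inc e).val.map d = c v ::ₘ Finset.univ.val.map l →
        H.coverCount d l w e = C) := by
    by_cases hG : ∃ e, v ∈ G.inc e ∧ (G.inc e).val.map c = c v ::ₘ Finset.univ.val.map l
    · obtain ⟨e, he, hem⟩ := hG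
      exact ⟨G.coverCount c l v e, coverCount_ne_zero he hem,
        fun f hf => coverCount_congr l rfl hf.1 he (hf.2.trans hem.symm),
        fun f hf => coverCount_congr l hvw.symm hf.1 he (hf.2.trans hem.symm)⟩
    by_cases hH : ∃ e, w ∈ H.inc e ∧ (H.inc e).val.map d = c v ::ₘ Finset.univ.val.map l
    · obtain ⟨e, he, hem⟩ := hH
      exact ⟨H.coverCount d l w e, coverCount_ne_zero he (hem.trans (by rw [hvw])),
        fun f hf => coverCount_congr l hvw hf.1 he (hf.2.trans hem.symm),
        fun f hf => coverCount_congr l rfl hf.1 he (hf.2.trans hem.symm)⟩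
    · exact ⟨1, one_ne_zero, fun e he => (hG ⟨e, he⟩).elim, fun e he => (hH ⟨e, he⟩).elim⟩
  obtain ⟨C, hC, hCG, hCH⟩ := hconst
  rw [Finset.sum_congr rfl fun e he => hCG e (Finset.mem_filter.1 he).2,
    Finset.sum_congr rfl fun e he => hCH e (Finset.mem_filter.1 he).2,
    Finset.sum_const, Finset.sum_const, smul_eq_mul, smul_eq_mul] at htop
  have hcard := Nat.eq_of_mul_eq_mul_right (Nat.pos_of_ne_zero hC) htop
  rw [edgeColors, edgeColors, Multiset.count_map, Multiset.count_map, ← Finset.filter_val,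
    ← Finset.filter_val, Finset.filter_filter, Finset.filter_filter, Finset.card_val,
    Finset.card_val]
  simpa only [eq_comm (a := c v ::ₘ _)] using hcard

open Classical in
theorem sum_coverCount_eq_sum_cover [Fintype V] (G : MultiHypergraph V E) (c : V → Q) {k : ℕ}
    (l : Fin k → Q) (v : V) :
    ((∑ e, G.coverCount c l v e : ℕ) : ℚ) =
      ∑ p : G.Cover k v, ∏ j, if c (p.1.2 j) = l j then (1 : ℚ) else 0 := by
  have h : ∀ p : G.Cover k v, (∏ j, if c (p.1.2 j) = l j then (1 : ℚ) else 0) =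
      if ∀ j, c (p.1.2 j) = l j then 1 else 0 := fun p => by
    rw [Finset.prod_boole]
    simp
  rw [Finset.sum_congr rfl fun p _ => h p, Finset.sum_boole, ← Fintype.card_subtype, ← Nat.card_eq_fintype_card]
  unfold coverCount
  rw [← Nat.card_sigma]
  congr 1
  exact Nat.card_congr ⟨fun q => ⟨⟨(q.1, q.2.1), q.2.2.1⟩, fun j => q.2.2.2 j⟩,
    fun p => ⟨p.1.1.1, p.1.1.2, p.1.2, p.2⟩,
    fun _ => rfl, fun _ => rfl⟩

end Coloring

/-! ### Profiles refine all colours -/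

section Refinement

variable {V E V' E' : Type*} [Fintype V] [Fintype E] [Fintype V'] [Fintype E']

open Classical in
theorem edgeColors_profile_eq {G : MultiHypergraph V E} {H : MultiHypergraph V' E'} {v : V}
    {w : V'} (h : G.profile v = H.profile w) :
    G.edgeColors G.profile v = H.edgeColors H.profile w := by
  refine edgeColors_eq h fun k l => ?_
  have key := sum_cover_prod_eq h (fun j q => if q = l j then (1 : ℚ) else 0)
  rw [← sum_coverCount_eq_sum_cover, ← sum_coverCount_eq_sum_cover] at key
  exact_mod_cast key

theorem color_eq_of_profile_eq {G : MultiHypergraph V E} {H : MultiHypergraph V' E'} (i : ℕ)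
    {v : V} {w : V'} (h : G.profile v = H.profile w) : G.color i v = H.color i w := by
  classical
  induction i generalizing v w with
  | zero => rfl
  | succ i ih =>
    obtain ⟨σ, hσ⟩ := Finset.exists_equiv_of_map_val_eq (edgeColors_profile_eq h)
    rw [color_succ, color_succ]
    refine Finset.map_val_eq_of_equiv σ fun e => ?_
    obtain ⟨τ, hτ⟩ := Finset.exists_equiv_of_map_val_eq (hσ e).symm
    exact (Finset.map_val_eq_of_equiv τ fun u => (ih (hτ u).symm).symm).symm

theorem not_distinguishes_of_sum_count_eq {G : MultiHypergraph V E} {H : MultiHypergraph V' E'}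
    (h : ∀ T : TreeCode, ∑ v, T.count G v = ∑ w, T.count H w) :
    ¬ ColorRefinementDistinguishes G H := by
  rintro ⟨i, hi⟩
  obtain ⟨σ, hσ⟩ := Finset.exists_equiv_of_map_val_eq (map_profile_eq h)
  exact hi (Finset.map_val_eq_of_equiv σ fun v => color_eq_of_profile_eq i (hσ v)|>.symm ▸ rfl)

end Refinement

end MultiHypergraph

theorem theorem1
    {V E V' E' : Type*} [Fintype V] [Fintype E] [Fintype V'] [Fintype E']
    (G : MultiHypergraph V E) (H : MultiHypergraph V' E') :
    (∀ (W D : Type*) [Finite W] [Finite D] (B : MultiHypergraph W D),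
      B.IsConnected → B.IsBergeAcyclic → B.homCount G = B.homCount H) ↔
    ¬ MultiHypergraph.ColorRefinementDistinguishes G H := by
  refine ⟨fun h => MultiHypergraph.not_distinguishes_of_sum_count_eq
    (MultiHypergraph.TreeCode.sum_count_eq G H h), fun h W D _ _ B hc ha => ?_⟩
  exact MultiHypergraph.homCount_eq_of_not_distinguishes h hc ha
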